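/- Let $0<\theta<1$. For $N\ge 1$ choose an interview order $\pi\in\mathfrak S_N$ (where $\pi_i$ is the rank of the $i$-th candidate and rank $N$ is best) from the Mallows distribution, i.e. with probability proportional to $\theta^{\mathrm{inv}(\pi)}$, where $\mathrm{inv}(\pi)$ is the number of pairs $i<l$ with $\pi_i>\pi_l$. At step $i$ the interviewer sees only the prefix of size $i$: the permutation in $\mathfrak S_i$ with the same relative order as $\pi_1,\dots,\pi_i$. A strategy is a set of prefixes (a strike set): the first candidate whose prefix lies in the set is accepted, and the game is won if this candidate has rank $N$. A strategy is optimal if no strategy wins with larger probability. A prefix is eligible if its last entry is a left-to-right maximum (exceeds all entries before it) or if it has size $N$; a strike set is valid if it consists of eligible prefixes, no element of it is a proper prefix of another element, and every $\pi\in\mathfrak S_N$ has a prefix in it. The positional strategy "reject the first $k$ candidates and select the next left-to-right maximum thereafter" is the strike set of those eligible prefixes of size $>k$ that have no proper prefix which is eligible and of size $>k$. Put $J=\max(-1/\ln\theta,\,1)$. Then: 1. For every integer $j\ge 1$, the strategy that rejects the first $N-j$ candidates and selects the next left-to-right maximum thereafter succeeds with probability tending to $j\,\theta^{j-1}(1-\theta)$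 as $N\to\infty$. 2. Over real $x\ge 1$, the function $x\,\theta^{x-1}(1-\theta)$ attains its maximum at $x=J$ and only there. 3. There is an integer $j\ge1$, equal to $\lfloor J\rfloor$ or to $\lceil J\rceil$ (so $j=J$ if $J$ is an integer, in particular $j=1$ if $\theta\le 1/e$), such that for all sufficiently large $N$ the strategy that rejects the first $N-j$ candidates and selects the next left-to-right maximum thereafter is valid and optimal, and is the only valid strike set that is optimal. 4. If $1/e<\theta<1$, then the maximal value in 2 is $$J\,\theta^{J-1}(1-\theta)=e^{-1}\left(\frac{\theta-1}{\theta\ln\theta}\right).$$ By 1 and 3, this value is the limiting success probability of the optimal strategy when $J$ is an integer; otherwise that limit is $j\,\theta^{j-1}(1-\theta)$ with the $j$ of 3, which is strictly smaller. -/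

import Mathlib

open Filter Topology

namespace BestChoice

/-- The number of indices in `Fin m` whose entry is smaller than the entry at `a`. -/
def relRank {m n : ℕ} (h : m ≤ n) (π : Equiv.Perm (Fin n)) (a : Fin m) : ℕ :=
  (Finset.univ.filter fun b : Fin m => π (Fin.castLE h b) < π (Fin.castLE h a)).card

theorem relRank_lt {m n : ℕ} (h : m ≤ n) (π : Equiv.Perm (Fin n)) (a : Fin m) :
    relRank h π a < m := by
  have h1 : (Finset.univ.filter fun b : Fin m =>
      π (Fin.castLE h b) < π (Fin.castLE h a)) ⊂ Finset.univ := by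
    rw [Finset.ssubset_univ_iff]
    intro hu
    have := Finset.mem_univ a
    rw [← hu] at this
    simp at this
  simpa [relRank] using Finset.card_lt_card h1

theorem relRank_lt_relRank {m n : ℕ} (h : m ≤ n) (π : Equiv.Perm (Fin n)) (a b : Fin m)
    (hab : π (Fin.castLE h a) < π (Fin.castLE h b)) : relRank h π a < relRank h π b := by
  apply Finset.card_lt_card
  refine Finset.ssubset_iff_of_subset (fun c hc => ?_) |>.2 ⟨a, by simpa using hab, by simp⟩
  simp only [Finset.mem_filter, Finset.mem_univ, true_and] at hc ⊢
  exact hc.trans hab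

theorem relRank_bijective {m n : ℕ} (h : m ≤ n) (π : Equiv.Perm (Fin n)) :
    Function.Bijective (fun a : Fin m => (⟨relRank h π a, relRank_lt h π a⟩ : Fin m)) := by
  refine Finite.injective_iff_bijective.mp fun a b hab => ?_
  have hv : relRank h π a = relRank h π b := congrArg Fin.val hab
  rcases lt_trichotomy (π (Fin.castLE h a)) (π (Fin.castLE h b)) with hl | he | hg
  · exact absurd hv (relRank_lt_relRank h π a b hl).ne
  · exact Fin.castLE_injective h (π.injective he)
  · exact absurd hv (relRank_lt_relRank h π b a hg).ne'

/-- An interview order of `n` candidates is `π : Equiv.Perm (Fin n)`: `π i` is the rank of the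
`i`-th interviewed candidate (positions and ranks start at `0`, rank `n - 1` is best).
`flatten h π` is the prefix flattening of size `m`: the permutation of `Fin m` with the same
relative order as the first `m` entries of `π`. -/
noncomputable def flatten {m n : ℕ} (h : m ≤ n) (π : Equiv.Perm (Fin n)) : Equiv.Perm (Fin m) :=
  Equiv.ofBijective _ (relRank_bijective h π)

theorem flatten_lt_flatten_iff {m n : ℕ} (h : m ≤ n) (π : Equiv.Perm (Fin n)) (a b : Fin m) :
    flatten h π a < flatten h π b ↔ π (Fin.castLE h a) < π (Fin.castLE h b) := by
  refine ⟨fun hlt => ?_, fun hlt => relRank_lt_relRank h π a b hlt⟩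
  by_contra hn
  rcases (not_lt.mp hn).lt_or_eq with hg | he
  · exact lt_asymm hlt (relRank_lt_relRank h π b a hg)
  · rw [Fin.castLE_injective h (π.injective he)] at hlt
    exact lt_irrefl _ hlt

/-- A possible position in the game with `N` candidates: a permutation of size
`1, 2, …, N`. The element `⟨i, p⟩` has size `i + 1`. -/
abbrev Prefix (N : ℕ) : Type := Σ i : Fin N, Equiv.Perm (Fin (i.val + 1))

/-- The number of candidates seen so far. -/
def Prefix.size {N : ℕ} (p : Prefix N) : ℕ := p.1.val + 1

/-- What the interviewer sees when candidate `i` of the interview order `π` is presented. -/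
noncomputable def seen {N : ℕ} (π : Equiv.Perm (Fin N)) (i : Fin N) : Prefix N :=
  ⟨i, flatten i.isLt π⟩

/-- Containment of prefixes: `q` is one of the prefix flattenings of `p`. -/
def Prefix.IsPrefixOf {N : ℕ} (q p : Prefix N) : Prop :=
  ∃ h : q.1.val + 1 ≤ p.1.val + 1, flatten h p.2 = q.2

/-- The last entry of `p` is a left-to-right maximum of `p`. -/
def Prefix.EndsInMax {N : ℕ} (p : Prefix N) : Prop :=
  ∀ a : Fin (p.1.val + 1), a < Fin.last p.1.val → p.2 a < p.2 (Fin.last p.1.val)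

/-- A prefix is eligible if it ends in a left-to-right maximum or has full size. -/
def Prefix.Eligible {N : ℕ} (p : Prefix N) : Prop :=
  p.EndsInMax ∨ p.size = N

/-- A valid strike set: an antichain of eligible prefixes such that every interview order has
some element of it as a prefix. -/
structure IsValid {N : ℕ} (A : Set (Prefix N)) : Prop where
  eligible : ∀ p ∈ A, p.Eligible
  antichain : ∀ p ∈ A, ∀ q ∈ A, q.IsPrefixOf p → q = p
  covers : ∀ π : Equiv.Perm (Fin N), ∃ i : Fin N, seen π i ∈ A

/-- Playing the strategy with strike set `A`, i.e. accepting the first candidate at which the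
prefix shown lies in `A`, selects the best candidate of `π`. -/
def Wins {N : ℕ} (A : Set (Prefix N)) (π : Equiv.Perm (Fin N)) : Prop :=
  ∃ i : Fin N, seen π i ∈ A ∧ (∀ i' < i, seen π i' ∉ A) ∧ ∀ l : Fin N, π l ≤ π i

/-- The number of inversions of `π`. -/
def inversions {N : ℕ} (π : Equiv.Perm (Fin N)) : ℕ :=
  (Finset.univ.filter fun x : Fin N × Fin N => x.1 < x.2 ∧ π x.2 < π x.1).card

/-- The probability of `π` in the Mallows distribution with parameter `θ`. -/
noncomputable def mallows (θ : ℝ) {N : ℕ} (π : Equiv.Perm (Fin N)) : ℝ :=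
  θ ^ inversions π / ∑ σ : Equiv.Perm (Fin N), θ ^ inversions σ

open Classical in
/-- The probability of winning with strike set `A` when the interview order has the Mallows
distribution with parameter `θ`. -/
noncomputable def winProb (θ : ℝ) {N : ℕ} (A : Set (Prefix N)) : ℝ :=
  ∑ π : Equiv.Perm (Fin N), if Wins A π then mallows θ π else 0

/-- No strategy whatsoever wins with a larger probability than `A`. -/
def IsOptimal (θ : ℝ) {N : ℕ} (A : Set (Prefix N)) : Prop :=
  ∀ B : Set (Prefix N), winProb θ B ≤ winProb θ A

/-- The positional strategy: reject the first `k` candidates and accept the next left-to-right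
maximum thereafter (the last candidate being taken if none appears). As a strike set: the
eligible prefixes of size larger than `k` that are minimal under containment. -/
def positional (N k : ℕ) : Set (Prefix N) :=
  {p | k < p.size ∧ p.Eligible ∧
    ∀ q : Prefix N, q.IsPrefixOf p → k < q.size → q.Eligible → q = p}

end BestChoice

namespace BestChoice

/-! Under the Mallows law the relative rank of each new candidate is independent of the prefix
before it (`mallows_extend`), so the events "candidate `l + 1` is a left-to-right maximum" (a
record) are independent coin tosses, with odds `(1 - θ) / (θ * (1 - θ ^ l))` for `l ≥ 1`. Winning
means stopping at the last record, and the odds rule applies: accept a record once the odds of the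
later candidates sum to less than 1. Optimality among all strike sets is a verification argument. A
partial order scores `Q` if the accepted candidate still leads, `0` if it has been overtaken, and
`V` if nobody has been accepted. The mean score runs from `V 0` to the winning probability, and for
the right `V` each step loses a nonnegative amount (`value_sub_winProb`,
`IsOptimalValue.winProb_le`). Zero total loss forces every reachable decision at a record
(`IsOptimalValue.mem_iff`), and validity forces the rest. As `N → ∞`, the odds of the last `j`
candidates sum to a quantity that tends to `j * (1 - θ) / θ` and stays strictly above it, so `j = ⌈θ
/ (1 - θ)⌉₊` is the unique optimum even when `j * (1 - θ) = θ`. Finally `-1 / log θ` lies strictly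
between `θ / (1 - θ)` and `θ / (1 - θ) + 1`, which makes this `j` a rounding of `J`. -/

/-! ### Flattening, and building permutations one entry at a time -/

theorem card_filter_perm_lt {n : ℕ} (σ : Equiv.Perm (Fin n)) (a : Fin n) :
    (Finset.univ.filter fun b : Fin n => σ b < σ a).card = (σ a).val := by
  rw [← Fin.card_Iio (σ a)]
  exact Finset.card_equiv σ (by simp)

theorem flatten_eq_of_lt_iff {m n : ℕ} (h : m ≤ n) (π : Equiv.Perm (Fin n))
    (σ : Equiv.Perm (Fin m))
    (hσ : ∀ a b, σ a < σ b ↔ π (Fin.castLE h a) < π (Fin.castLE h b)) : flatten h π = σ := by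
  ext a
  rw [← card_filter_perm_lt σ a]
  simp only [hσ]
  rfl

theorem flatten_self {n : ℕ} (h : n ≤ n) (π : Equiv.Perm (Fin n)) : flatten h π = π :=
  flatten_eq_of_lt_iff h π π fun _ _ => Iff.rfl

theorem flatten_flatten {l m n : ℕ} (h : l ≤ m) (h' : m ≤ n) (π : Equiv.Perm (Fin n)) :
    flatten h (flatten h' π) = flatten (h.trans h') π :=
  (flatten_eq_of_lt_iff _ _ _ fun a b => by
    rw [flatten_lt_flatten_iff, flatten_lt_flatten_iff]; rfl).symm

/-- The permutation of size `n + 1` that ends in `c` and flattens to `σ`. -/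
def extend {n : ℕ} (σ : Equiv.Perm (Fin n)) (c : Fin (n + 1)) : Equiv.Perm (Fin (n + 1)) :=
  (finSuccEquiv' (Fin.last n)).trans (σ.optionCongr.trans (finSuccEquiv' c).symm)

theorem extend_last {n : ℕ} (σ : Equiv.Perm (Fin n)) (c : Fin (n + 1)) :
    extend σ c (Fin.last n) = c := by
  simp [extend]

theorem extend_castSucc {n : ℕ} (σ : Equiv.Perm (Fin n)) (c : Fin (n + 1)) (a : Fin n) :
    extend σ c a.castSucc = c.succAbove (σ a) := by
  have : finSuccEquiv' (Fin.last n) a.castSucc = some a := by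
    rw [← Fin.succAbove_last_apply, finSuccEquiv'_succAbove]
  simp [extend, this]

theorem flatten_extend {n : ℕ} (σ : Equiv.Perm (Fin n)) (c : Fin (n + 1)) :
    flatten n.le_succ (extend σ c) = σ := by
  refine flatten_eq_of_lt_iff _ _ _ fun a b => ?_
  change _ ↔ extend σ c a.castSucc < extend σ c b.castSucc
  rw [extend_castSucc, extend_castSucc, (Fin.strictMono_succAbove c).lt_iff_lt]

theorem extend_bijective (n : ℕ) :
    Function.Bijective fun x : Equiv.Perm (Fin n) × Fin (n + 1) => extend x.1 x.2 := by
  rw [Fintype.bijective_iff_injective_and_card]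
  refine ⟨fun x y hxy => ?_, ?_⟩
  · dsimp only at hxy
    ext1
    · rw [← flatten_extend x.1 x.2, hxy, flatten_extend]
    · rw [← extend_last x.1 x.2, hxy, extend_last]
  · simp [Fintype.card_perm, Nat.factorial_succ, mul_comm]

theorem exists_eq_extend {n : ℕ} (π : Equiv.Perm (Fin (n + 1))) :
    π = extend (flatten n.le_succ π) (π (Fin.last n)) := by
  obtain ⟨⟨σ, c⟩, rfl⟩ := (extend_bijective n).2 π
  dsimp only
  rw [flatten_extend, extend_last]

/-! ### The Mallows law as a product of relative rank laws -/

theorem inversions_eq_sum {n : ℕ} (π : Equiv.Perm (Fin n)) :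
    inversions π = ∑ y, ∑ x, if x < y ∧ π y < π x then 1 else 0 := by
  rw [inversions, Finset.card_filter, Fintype.sum_prod_type_right]

/-- The new inversions pair the last entry with the values above `c`; their number does not depend
on `σ`, which is the source of independence. -/
theorem inversions_extend {n : ℕ} (σ : Equiv.Perm (Fin n)) (c : Fin (n + 1)) :
    inversions (extend σ c) = inversions σ + (n - c.val) := by
  have h : (∑ x : Fin n, if c < c.succAbove (σ x) then 1 else 0) = n - c.val := by
    have hc : (Finset.Ioi c).card = n - c.val := by simp
    rw [Equiv.sum_comp σ fun x => if c < c.succAbove x then 1 else 0, ← hc,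
      ← Finset.filter_lt_eq_Ioi, Finset.card_filter, Fin.sum_univ_succAbove _ c]
    simp
  rw [inversions_eq_sum, Fin.sum_univ_castSucc, inversions_eq_sum]
  simp only [Fin.sum_univ_castSucc, extend_castSucc, extend_last]
  simp [(Fin.strictMono_succAbove c).lt_iff_lt, Fin.castSucc_lt_last, h,
    (Fin.castSucc_lt_last _).not_gt]

/-- The probability that candidate `n + 1` has rank `c` among the first `n + 1` candidates. -/
noncomputable def rankProb (θ : ℝ) (n : ℕ) (c : Fin (n + 1)) : ℝ :=
  θ ^ (n - c.val) / ∑ d : Fin (n + 1), θ ^ (n - d.val)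

theorem sum_perm_succ {n : ℕ} (f : Equiv.Perm (Fin (n + 1)) → ℝ) :
    ∑ π, f π = ∑ σ : Equiv.Perm (Fin n), ∑ c, f (extend σ c) := by
  rw [← Fintype.sum_prod_type']
  exact (Function.Bijective.sum_comp (extend_bijective n) f).symm

theorem mallows_extend (θ : ℝ) {n : ℕ} (σ : Equiv.Perm (Fin n)) (c : Fin (n + 1)) :
    mallows θ (extend σ c) = mallows θ σ * rankProb θ n c := by
  rw [mallows, mallows, rankProb, sum_perm_succ, inversions_extend]
  simp only [inversions_extend, pow_add]
  rw [← Finset.sum_mul_sum, div_mul_div_comm]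

theorem sum_mallows_succ (θ : ℝ) {n : ℕ} (f : Equiv.Perm (Fin (n + 1)) → ℝ) :
    ∑ π, mallows θ π * f π =
      ∑ σ : Equiv.Perm (Fin n), mallows θ σ * ∑ c, rankProb θ n c * f (extend σ c) := by
  rw [sum_perm_succ]
  simp only [mallows_extend, Finset.mul_sum, mul_assoc]

theorem mallows_pos {θ : ℝ} (h : 0 < θ) {n : ℕ} (σ : Equiv.Perm (Fin n)) : 0 < mallows θ σ :=
  div_pos (pow_pos h _) (Finset.sum_pos (fun _ _ => pow_pos h _) Finset.univ_nonempty)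

theorem rankProb_pos {θ : ℝ} (h : 0 < θ) {n : ℕ} (c : Fin (n + 1)) : 0 < rankProb θ n c :=
  div_pos (pow_pos h _) (Finset.sum_pos (fun _ _ => pow_pos h _) Finset.univ_nonempty)

theorem sum_rankProb {θ : ℝ} (h : 0 < θ) (n : ℕ) : ∑ c, rankProb θ n c = 1 := by
  simp only [rankProb]
  rw [← Finset.sum_div]
  exact div_self (Finset.sum_pos (fun _ _ => pow_pos h _) Finset.univ_nonempty).ne'

theorem rankProb_last {θ : ℝ} (h : θ < 1) (n : ℕ) :
    rankProb θ n (Fin.last n) = (1 - θ) / (1 - θ ^ (n + 1)) := by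
  have hs : ∑ d : Fin (n + 1), θ ^ (n - d.val) = (1 - θ ^ (n + 1)) / (1 - θ) := by
    rw [Fin.sum_univ_eq_sum_range (fun d => θ ^ (n - d)) (n + 1),
      ← Finset.sum_range_reflect, ← neg_div_neg_eq, neg_sub, neg_sub, ← geom_sum_eq h.ne]
    refine Finset.sum_congr rfl fun i hi => ?_
    rw [Finset.mem_range] at hi
    congr 1
    lia
  simp [rankProb, hs]

/-! ### How stopping and leading evolve when a candidate is added -/

section

variable {N : ℕ}

/-- Some prefix of `σ` lies in `A`. -/
def Stopped (A : Set (Prefix N)) {n : ℕ} (σ : Equiv.Perm (Fin n)) : Prop :=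
  ∃ (m : Fin N) (h : m.val + 1 ≤ n), (⟨m, flatten h σ⟩ : Prefix N) ∈ A

/-- The candidate accepted by the strike set `A` is the best one in `σ`. -/
def Leads (A : Set (Prefix N)) {n : ℕ} (σ : Equiv.Perm (Fin n)) : Prop :=
  ∃ (m : Fin N) (h : m.val + 1 ≤ n), (⟨m, flatten h σ⟩ : Prefix N) ∈ A ∧
    (∀ (m' : Fin N) (h' : m'.val + 1 ≤ n), m' < m → (⟨m', flatten h' σ⟩ : Prefix N) ∉ A) ∧
    ∀ l : Fin n, σ l ≤ σ ⟨m.val, h⟩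

theorem Leads.stopped {A : Set (Prefix N)} {n : ℕ} {σ : Equiv.Perm (Fin n)} (h : Leads A σ) :
    Stopped A σ := by
  obtain ⟨m, hm, hA, -⟩ := h
  exact ⟨m, hm, hA⟩

theorem wins_iff_leads (A : Set (Prefix N)) (π : Equiv.Perm (Fin N)) :
    Wins A π ↔ Leads A π := by
  constructor
  · rintro ⟨i, hA, hlt, hmax⟩
    exact ⟨i, i.isLt, hA, fun m' _ hm' => hlt m' hm', hmax⟩
  · rintro ⟨i, h, hA, hlt, hmax⟩
    exact ⟨i, hA, fun m' hm' => hlt m' m'.isLt hm', hmax⟩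

theorem not_stopped_zero (A : Set (Prefix N)) (σ : Equiv.Perm (Fin 0)) : ¬ Stopped A σ := by
  rintro ⟨m, h, -⟩
  exact absurd h (by lia)

theorem stopped_extend_iff (A : Set (Prefix N)) {n : ℕ} (hn : n < N) (σ : Equiv.Perm (Fin n))
    (c : Fin (n + 1)) :
    Stopped A (extend σ c) ↔ Stopped A σ ∨ (⟨⟨n, hn⟩, extend σ c⟩ : Prefix N) ∈ A := by
  constructor
  · rintro ⟨m, h, hA⟩
    rcases h.lt_or_eq with hlt | heq
    · left
      refine ⟨m, by lia, ?_⟩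
      rw [← flatten_flatten (by lia) n.le_succ, flatten_extend] at hA
      exact hA
    · right
      obtain rfl : m = ⟨n, hn⟩ := Fin.ext (by simpa using heq)
      rwa [flatten_self] at hA
  · rintro (⟨m, h, hA⟩ | hA)
    · refine ⟨m, by lia, ?_⟩
      rw [← flatten_flatten h n.le_succ, flatten_extend]
      exact hA
    · refine ⟨⟨n, hn⟩, le_rfl, ?_⟩
      rwa [flatten_self]

theorem extend_le_extend_iff {n : ℕ} (σ : Equiv.Perm (Fin n)) (c : Fin (n + 1)) (a b : Fin n) :
    extend σ c a.castSucc ≤ extend σ c b.castSucc ↔ σ a ≤ σ b := by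
  rw [extend_castSucc, extend_castSucc, (Fin.strictMono_succAbove c).le_iff_le]

/-- After acceptance the strategy has no more influence: the lead is lost exactly when a new record
appears. -/
theorem leads_extend_of_stopped {A : Set (Prefix N)} {n : ℕ} (hn : n < N)
    {σ : Equiv.Perm (Fin n)} (hs : Stopped A σ) (c : Fin (n + 1)) :
    Leads A (extend σ c) ↔ Leads A σ ∧ c ≠ Fin.last n := by
  constructor
  · rintro ⟨m, h, hA, hlt, hmax⟩
    have hm : m.val + 1 ≤ n := by
      by_contra hcon
      obtain ⟨m', h', hA'⟩ := hs
      refine hlt m' (by lia) (Fin.lt_def.2 (by lia)) ?_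
      rw [← flatten_flatten h' n.le_succ, flatten_extend]
      exact hA'
    refine ⟨⟨m, hm, ?_, fun m' h' hm' => ?_, fun l => ?_⟩, ?_⟩
    · rwa [← flatten_flatten hm n.le_succ, flatten_extend] at hA
    · have := hlt m' (by lia) hm'
      rwa [← flatten_flatten h' n.le_succ, flatten_extend] at this
    · exact (extend_le_extend_iff σ c l ⟨m, hm⟩).1 (hmax l.castSucc)
    · rintro rfl
      have h1 := hmax (Fin.last n)
      rw [extend_last, Fin.last_le_iff] at h1
      have := congrArg Fin.val ((extend σ (Fin.last n)).injective
        (h1.trans (extend_last σ (Fin.last n)).symm))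
      simp only [Fin.val_last] at this
      lia
  · rintro ⟨⟨m, h, hA, hlt, hmax⟩, hc⟩
    refine ⟨m, by lia, ?_, fun m' h' hm' => ?_, fun l => ?_⟩
    · rwa [← flatten_flatten h n.le_succ, flatten_extend]
    · rw [← flatten_flatten (by have := Fin.lt_def.1 hm'; lia) n.le_succ, flatten_extend]
      exact hlt m' _ hm'
    · change _ ≤ extend σ c (Fin.castSucc ⟨m, h⟩)
      induction l using Fin.lastCases with
      | cast l => exact (extend_le_extend_iff σ c l ⟨m, h⟩).2 (hmax l)
      | last =>
        have hn0 : n ≠ 0 := by lia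
        obtain ⟨t, rfl⟩ := Nat.exists_eq_succ_of_ne_zero hn0
        have h1 : σ ⟨m, h⟩ = Fin.last t := by
          rw [← Fin.last_le_iff, ← σ.apply_symm_apply (Fin.last t)]
          exact hmax _
        -- Since `c` is not the top rank, inserting it shifts the leader's old top rank to the new
        -- top rank.
        rw [extend_last, extend_castSucc, h1, Fin.succAbove_ne_last_last hc]
        exact Fin.le_last _

theorem leads_extend_of_not_stopped {A : Set (Prefix N)} {n : ℕ} (hn : n < N)
    {σ : Equiv.Perm (Fin n)} (hs : ¬ Stopped A σ) (c : Fin (n + 1)) :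
    Leads A (extend σ c) ↔
      (⟨⟨n, hn⟩, extend σ c⟩ : Prefix N) ∈ A ∧ c = Fin.last n := by
  constructor
  · rintro ⟨m, h, hA, -, hmax⟩
    rcases h.lt_or_eq with hlt | heq
    · refine absurd ⟨m, by lia, ?_⟩ hs
      rw [← flatten_flatten (by lia) n.le_succ, flatten_extend] at hA
      exact hA
    · obtain rfl : m = ⟨n, hn⟩ := Fin.ext (by simpa using heq)
      rw [flatten_self] at hA
      refine ⟨hA, ?_⟩
      have := hmax ((extend σ c).symm (Fin.last n))
      rw [Equiv.apply_symm_apply, Fin.last_le_iff] at this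
      rw [← this]
      exact (extend_last σ c).symm
  · rintro ⟨hA, rfl⟩
    refine ⟨⟨n, hn⟩, le_rfl, by rwa [flatten_self], fun m' h' hm' hA' => hs ?_, fun l => ?_⟩
    · have hm : m'.val + 1 ≤ n := Fin.lt_def.1 hm'
      refine ⟨m', hm, ?_⟩
      rw [← flatten_flatten hm n.le_succ, flatten_extend] at hA'
      exact hA'
    · change _ ≤ extend σ (Fin.last n) (Fin.last n)
      rw [extend_last]
      exact Fin.le_last _

/-! ### Scores and their expected loss per step -/

open Classical in
/-- The value of the game played with strike set `A` after seeing `σ`, where `Q n` is the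
probability that the best of the first `n` candidates stays the best, and `V n` the value of
continuing after `n` rejections. -/
noncomputable def score (A : Set (Prefix N)) (Q V : ℕ → ℝ) {n : ℕ} (σ : Equiv.Perm (Fin n)) : ℝ :=
  if Leads A σ then Q n else if Stopped A σ then 0 else V n

theorem score_extend_of_leads {A : Set (Prefix N)} (Q V : ℕ → ℝ) {n : ℕ} (hn : n < N)
    {σ : Equiv.Perm (Fin n)} (hs : Leads A σ) (c : Fin (n + 1)) :
    score A Q V (extend σ c) = if c = Fin.last n then 0 else Q (n + 1) := by
  simp [score, leads_extend_of_stopped hn hs.stopped, stopped_extend_iff A hn, hs, hs.stopped]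

theorem score_extend_of_stopped {A : Set (Prefix N)} (Q V : ℕ → ℝ) {n : ℕ} (hn : n < N)
    {σ : Equiv.Perm (Fin n)} (hs : Stopped A σ) (hl : ¬ Leads A σ) (c : Fin (n + 1)) :
    score A Q V (extend σ c) = 0 := by
  simp [score, leads_extend_of_stopped hn hs, stopped_extend_iff A hn, hs, hl]

open Classical in
theorem score_extend_of_not_stopped {A : Set (Prefix N)} (Q V : ℕ → ℝ) {n : ℕ} (hn : n < N)
    {σ : Equiv.Perm (Fin n)} (hs : ¬ Stopped A σ) (c : Fin (n + 1)) :
    score A Q V (extend σ c) =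
      if (⟨⟨n, hn⟩, extend σ c⟩ : Prefix N) ∈ A then if c = Fin.last n then Q (n + 1) else 0
      else V (n + 1) := by
  simp only [score, leads_extend_of_not_stopped hn hs, stopped_extend_iff A hn, hs, false_or]
  by_cases h1 : (⟨⟨n, hn⟩, extend σ c⟩ : Prefix N) ∈ A
  · simp only [h1, true_and, if_true]
  · simp only [h1, false_and, if_false]

theorem sum_rankProb_mul_ite {θ : ℝ} (h : 0 < θ) (n : ℕ) (a b : ℝ) :
    ∑ c, rankProb θ n c * (if c = Fin.last n then a else b) =
      rankProb θ n (Fin.last n) * a + (1 - rankProb θ n (Fin.last n)) * b := by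
  rw [← sum_rankProb h n, Fin.sum_univ_castSucc, Fin.sum_univ_castSucc]
  simp [(Fin.castSucc_lt_last _).ne, Finset.sum_mul]
  ring

/-- `Q` and `V` describe the game of length `N` in which left-to-right maxima among the first `k`
candidates are rejected, and later ones are accepted. -/
structure IsValue (θ : ℝ) (N k : ℕ) (Q V : ℕ → ℝ) : Prop where
  pos : 0 < θ
  stay_end : Q N = 1
  value_end : V N = 0
  value_nonneg : ∀ n, 0 ≤ V n
  stay_step : ∀ n < N, Q n = (1 - rankProb θ n (Fin.last n)) * Q (n + 1)
  value_step : ∀ n < N, V n = rankProb θ n (Fin.last n) *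
    (if k < n + 1 then Q (n + 1) else V (n + 1)) + (1 - rankProb θ n (Fin.last n)) * V (n + 1)

theorem winProb_eq_sum_score {θ : ℝ} {k : ℕ} {Q V : ℕ → ℝ} (h : IsValue θ N k Q V)
    (A : Set (Prefix N)) :
    winProb θ A = ∑ π : Equiv.Perm (Fin N), mallows θ π * score A Q V π := by
  refine Finset.sum_congr rfl fun π _ => ?_
  simp only [score, h.stay_end, h.value_end]
  by_cases hl : Leads A π
  · rw [if_pos ((wins_iff_leads A π).2 hl), if_pos hl, mul_one]
  · rw [if_neg (mt (wins_iff_leads A π).1 hl), if_neg hl, ite_self, mul_zero]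

theorem sum_score_zero {θ : ℝ} (A : Set (Prefix N)) (Q V : ℕ → ℝ) :
    ∑ σ : Equiv.Perm (Fin 0), mallows θ σ * score A Q V σ = V 0 := by
  have hl : ∀ σ : Equiv.Perm (Fin 0), ¬ Leads A σ := fun σ h =>
    not_stopped_zero A σ h.stopped
  simp [score, hl, not_stopped_zero, mallows]
  simp [inversions]

open Classical in
/-- The expected loss of value at `σ` against the strategy described by `V`. -/
theorem score_sub_sum_extend {θ : ℝ} {k : ℕ} {Q V : ℕ → ℝ} (h : IsValue θ N k Q V)
    (A : Set (Prefix N)) {n : ℕ} (hn : n < N) (σ : Equiv.Perm (Fin n)) :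
    score A Q V σ - ∑ c, rankProb θ n c * score A Q V (extend σ c) =
      if Stopped A σ then 0 else ∑ c, rankProb θ n c *
        ((if c = Fin.last n then (if k < n + 1 then Q (n + 1) else V (n + 1)) else V (n + 1)) -
          if (⟨⟨n, hn⟩, extend σ c⟩ : Prefix N) ∈ A then
            if c = Fin.last n then Q (n + 1) else 0 else V (n + 1)) := by
  by_cases hl : Leads A σ
  · simp only [score_extend_of_leads Q V hn hl, sum_rankProb_mul_ite h.pos, hl.stopped, if_true]
    rw [score, if_pos hl, h.stay_step n hn]
    ring
  by_cases hs : Stopped A σ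
  · simp only [score_extend_of_stopped Q V hn hs hl, hs, if_true]
    rw [score, if_neg hl, if_pos hs]
    simp
  · simp only [score_extend_of_not_stopped Q V hn hs, hs, if_false, mul_sub,
      Finset.sum_sub_distrib, sum_rankProb_mul_ite h.pos]
    rw [score, if_neg hl, if_neg hs, h.value_step n hn]

theorem sum_score_sub_succ {θ : ℝ} (A : Set (Prefix N)) (Q V : ℕ → ℝ) (n : ℕ) :
    ∑ σ : Equiv.Perm (Fin n), mallows θ σ * score A Q V σ -
      ∑ π : Equiv.Perm (Fin (n + 1)), mallows θ π * score A Q V π =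
    ∑ σ : Equiv.Perm (Fin n), mallows θ σ *
      (score A Q V σ - ∑ c, rankProb θ n c * score A Q V (extend σ c)) := by
  rw [sum_mallows_succ]
  simp only [mul_sub, Finset.sum_sub_distrib]

/-- The mean score telescopes: it is `V 0` at the empty order and the winning probability at size
`N`. -/
theorem value_sub_winProb {θ : ℝ} {k : ℕ} {Q V : ℕ → ℝ} (h : IsValue θ N k Q V)
    (A : Set (Prefix N)) :
    V 0 - winProb θ A = ∑ n ∈ Finset.range N, ∑ σ : Equiv.Perm (Fin n), mallows θ σ *
      (score A Q V σ - ∑ c, rankProb θ n c * score A Q V (extend σ c)) := by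
  rw [winProb_eq_sum_score h, ← sum_score_zero (θ := θ) A Q V]
  simp only [← sum_score_sub_succ]
  exact (Finset.sum_range_sub' (fun n => ∑ σ : Equiv.Perm (Fin n),
    mallows θ σ * score A Q V σ) N).symm

/-- Stopping at left-to-right maxima exactly from candidate `k + 1` on yields the value `V 0`. -/
theorem winProb_eq_value {θ : ℝ} {k : ℕ} {Q V : ℕ → ℝ} (h : IsValue θ N k Q V)
    {A : Set (Prefix N)}
    (hmax : ∀ n (hn : n < N) (σ : Equiv.Perm (Fin n)), ¬ Stopped A σ →
      ((⟨⟨n, hn⟩, extend σ (Fin.last n)⟩ : Prefix N) ∈ A ↔ k < n + 1))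
    (hnot : ∀ n (hn : n < N) (σ : Equiv.Perm (Fin n)) (c : Fin (n + 1)), c ≠ Fin.last n →
      n + 1 < N → (⟨⟨n, hn⟩, extend σ c⟩ : Prefix N) ∉ A) :
    winProb θ A = V 0 := by
  symm
  rw [← sub_eq_zero, value_sub_winProb h]
  refine Finset.sum_eq_zero fun n hn => Finset.sum_eq_zero fun σ _ => ?_
  have hn := Finset.mem_range.1 hn
  rw [score_sub_sum_extend h A hn]
  by_cases hs : Stopped A σ
  · rw [if_pos hs, mul_zero]
  · rw [if_neg hs]
    refine mul_eq_zero_of_right _ (Finset.sum_eq_zero fun c _ => mul_eq_zero_of_right _ ?_)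
    by_cases hc : c = Fin.last n
    · subst hc
      simp only [hmax n hn σ hs, if_true, sub_self]
    · rcases (Nat.succ_le_of_lt hn).lt_or_eq with hlt | heq
      · simp [hnot n hn σ c hc hlt, hc]
      -- At size `N` a non-record is worthless whether accepted or rejected.
      · have : V (n + 1) = 0 := by rw [← h.value_end, ← heq]
        simp [hc, this]

/-! ### Verification: no strategy beats the value function -/

/-- `V` is the value function of the game: stopping at a left-to-right maximum of size `n` is
strictly better than continuing if and only if `k < n`. -/
structure IsOptimalValue (θ : ℝ) (N k : ℕ) (Q V : ℕ → ℝ) : Prop extends IsValue θ N k Q V where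
  lt_stay : ∀ n, k < n → n ≤ N → V n < Q n
  stay_lt : ∀ n, 0 < n → n ≤ k → Q n < V n

-- The difference is the payoff of the better decision minus that of the decision encoded by `P`;
-- accepting a non-record pays `0`, rejecting pays `V (n + 1) ≥ 0`.
open Classical in
theorem IsOptimalValue.loss_nonneg {θ : ℝ} {k : ℕ} {Q V : ℕ → ℝ} (h : IsOptimalValue θ N k Q V)
    (P : Prop) {n : ℕ} (hn : n < N) (c : Fin (n + 1)) :
    0 ≤ (if c = Fin.last n then (if k < n + 1 then Q (n + 1) else V (n + 1)) else V (n + 1)) -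
          if P then if c = Fin.last n then Q (n + 1) else 0 else V (n + 1) := by
  have h0 := h.value_nonneg (n + 1)
  by_cases hk : k < n + 1
  · have := h.lt_stay (n + 1) hk hn
    split_ifs <;> linarith
  · have := h.stay_lt (n + 1) n.succ_pos (by lia)
    split_ifs <;> linarith

theorem IsOptimalValue.drift_nonneg {θ : ℝ} {k : ℕ} {Q V : ℕ → ℝ}
    (h : IsOptimalValue θ N k Q V) (A : Set (Prefix N)) {n : ℕ} (hn : n < N)
    (σ : Equiv.Perm (Fin n)) :
    0 ≤ mallows θ σ * (score A Q V σ - ∑ c, rankProb θ n c * score A Q V (extend σ c)) := by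
  refine mul_nonneg (mallows_pos h.pos σ).le ?_
  rw [score_sub_sum_extend h.toIsValue A hn]
  by_cases hs : Stopped A σ
  · rw [if_pos hs]
  · rw [if_neg hs]
    exact Finset.sum_nonneg fun c _ => mul_nonneg (rankProb_pos h.pos c).le (h.loss_nonneg _ hn c)

theorem IsOptimalValue.winProb_le {θ : ℝ} {k : ℕ} {Q V : ℕ → ℝ} (h : IsOptimalValue θ N k Q V)
    (A : Set (Prefix N)) : winProb θ A ≤ V 0 := by
  rw [← sub_nonneg, value_sub_winProb h.toIsValue]
  exact Finset.sum_nonneg fun n hn => Finset.sum_nonneg fun σ _ =>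
    h.drift_nonneg A (Finset.mem_range.1 hn) σ

/-- An optimal strategy stops at left-to-right maxima exactly from candidate `k + 1` on. -/
theorem IsOptimalValue.mem_iff {θ : ℝ} {k : ℕ} {Q V : ℕ → ℝ} (h : IsOptimalValue θ N k Q V)
    {A : Set (Prefix N)} (hA : winProb θ A = V 0) {n : ℕ} (hn : n < N)
    {σ : Equiv.Perm (Fin n)} (hs : ¬ Stopped A σ) :
    (⟨⟨n, hn⟩, extend σ (Fin.last n)⟩ : Prefix N) ∈ A ↔ k < n + 1 := by
  have h0 := value_sub_winProb h.toIsValue A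
  -- The total loss vanishes, so every nonnegative summand does; positivity of the Mallows weight
  -- and of `rankProb` then isolates the single decision at the record.
  rw [hA, sub_self, eq_comm, Finset.sum_eq_zero_iff_of_nonneg fun n hn =>
    Finset.sum_nonneg fun σ _ => h.drift_nonneg A (Finset.mem_range.1 hn) σ] at h0
  have h1 := h0 n (Finset.mem_range.2 hn)
  rw [Finset.sum_eq_zero_iff_of_nonneg fun σ _ => h.drift_nonneg A hn σ] at h1
  have h2 := (mul_eq_zero.1 (h1 σ (Finset.mem_univ _))).resolve_left (mallows_pos h.pos σ).ne'
  rw [score_sub_sum_extend h.toIsValue A hn, if_neg hs, Finset.sum_eq_zero_iff_of_nonneg fun c _ =>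
    mul_nonneg (rankProb_pos h.pos c).le (h.loss_nonneg _ hn c)] at h2
  have h3 := (mul_eq_zero.1 (h2 (Fin.last n) (Finset.mem_univ _))).resolve_left
    (rankProb_pos h.pos _).ne'
  simp only [if_true] at h3
  by_cases hk : k < n + 1
  · have := h.lt_stay (n + 1) hk hn
    simp only [hk, if_true, iff_true] at h3 ⊢
    by_contra hcon
    rw [if_neg hcon] at h3
    linarith
  · have := h.stay_lt (n + 1) n.succ_pos (by lia)
    simp only [hk, if_false, iff_false] at h3 ⊢
    intro hcon
    rw [if_pos hcon] at h3
    linarith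

/-! ### Validity of positional strike sets, and uniqueness -/

theorem endsInMax_extend_iff {n : ℕ} (hn : n < N) (σ : Equiv.Perm (Fin n)) (c : Fin (n + 1)) :
    Prefix.EndsInMax (⟨⟨n, hn⟩, extend σ c⟩ : Prefix N) ↔ c = Fin.last n := by
  simp only [Prefix.EndsInMax]
  constructor
  · intro h
    by_contra hc
    have hlt : (extend σ c).symm (Fin.last n) < Fin.last n := by
      rw [Fin.lt_last_iff_ne_last]
      intro heq
      rw [Equiv.symm_apply_eq, extend_last] at heq
      exact hc heq.symm
    have := h _ hlt
    rw [Equiv.apply_symm_apply] at this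
    exact absurd this (Fin.le_last _).not_gt
  · rintro rfl a ha
    rw [extend_last, Fin.lt_last_iff_ne_last]
    intro heq
    exact ha.ne ((extend σ (Fin.last n)).injective (heq.trans (extend_last σ _).symm))

theorem Prefix.IsPrefixOf.refl (p : Prefix N) : p.IsPrefixOf p := ⟨le_rfl, flatten_self _ _⟩

theorem Prefix.IsPrefixOf.trans {p q r : Prefix N} (h : p.IsPrefixOf q) (h' : q.IsPrefixOf r) :
    p.IsPrefixOf r := by
  obtain ⟨h1, h2⟩ := h
  obtain ⟨h3, h4⟩ := h'
  exact ⟨h1.trans h3, by rw [← h2, ← h4, flatten_flatten]⟩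

theorem Prefix.IsPrefixOf.eq_of_size_le {p q : Prefix N} (h : p.IsPrefixOf q)
    (hs : q.1.val ≤ p.1.val) : p = q := by
  obtain ⟨i, σ⟩ := p
  obtain ⟨l, τ⟩ := q
  obtain ⟨h1, h2⟩ := h
  dsimp only at hs h1 h2
  obtain rfl : i = l := Fin.ext (by lia)
  rw [← h2, flatten_self]

theorem flatten_isPrefixOf {n : ℕ} (hn : n < N) (π : Equiv.Perm (Fin (n + 1))) (m : Fin N)
    (h : m.val + 1 ≤ n + 1) :
    Prefix.IsPrefixOf (⟨m, flatten h π⟩ : Prefix N) ⟨⟨n, hn⟩, π⟩ := ⟨h, rfl⟩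

/-- Below an eligible prefix of size larger than `k` there is an element of the positional
strike set. -/
theorem exists_positional_isPrefixOf {k : ℕ} (p : Prefix N) (hk : k < p.size)
    (hp : p.Eligible) : ∃ q ∈ positional N k, q.IsPrefixOf p := by
  induction hm : p.1.val using Nat.strong_induction_on generalizing p with
  | _ m ih =>
    by_cases hpos : p ∈ positional N k
    · exact ⟨p, hpos, .refl p⟩
    · have : ∃ q : Prefix N, q.IsPrefixOf p ∧ k < q.size ∧ q.Eligible ∧ q ≠ p := by
        by_contra! hcon
        exact hpos ⟨hk, hp, hcon⟩
      obtain ⟨q, hq, hkq, heq, hne⟩ := this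
      have hlt : q.1.val < m := by
        rw [← hm]
        by_contra hge
        exact hne (hq.eq_of_size_le (not_lt.1 hge))
      obtain ⟨r, hr, hrq⟩ := ih _ hlt q hkq heq rfl
      exact ⟨r, hr, hrq.trans hq⟩

theorem isValid_positional {k : ℕ} (hk : k < N) : IsValid (positional N k) where
  eligible p hp := hp.2.1
  antichain p hp q hq hqp := hp.2.2 q hqp hq.1 hq.2.1
  covers π := by
    have hN : N - 1 < N := by lia
    -- The complete order is eligible by its size, so a minimal eligible prefix lies below it.
    obtain ⟨q, hq, h1, h2⟩ := exists_positional_isPrefixOf (k := k) (seen π ⟨N - 1, hN⟩)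
      (by simp only [Prefix.size, seen]; lia) (Or.inr (by simp only [Prefix.size, seen]; lia))
    refine ⟨q.1, ?_⟩
    have h3 : flatten q.1.isLt π = q.2 :=
      (flatten_flatten h1 (Fin.isLt (⟨N - 1, hN⟩ : Fin N)) π).symm.trans h2
    rw [seen, h3]
    exact hq

/-- A valid strike set contains no extension of a permutation at which it has stopped. -/
theorem IsValid.extend_notMem {A : Set (Prefix N)} (hA : IsValid A) {n : ℕ} (hn : n < N)
    {σ : Equiv.Perm (Fin n)} (hs : Stopped A σ) (c : Fin (n + 1)) :
    (⟨⟨n, hn⟩, extend σ c⟩ : Prefix N) ∉ A := by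
  intro hmem
  obtain ⟨m, h, hm⟩ := hs
  have hp := flatten_isPrefixOf hn (extend σ c) m (by lia)
  rw [← flatten_flatten h n.le_succ, flatten_extend] at hp
  have := congrArg (fun p : Prefix N => p.1.val) (hA.antichain _ hmem _ hm hp)
  simp only at this
  lia

theorem IsValid.extend_notMem_of_ne_last {A : Set (Prefix N)} (hA : IsValid A) {n : ℕ}
    (hn : n + 1 < N) (σ : Equiv.Perm (Fin n)) {c : Fin (n + 1)} (hc : c ≠ Fin.last n) :
    (⟨⟨n, by lia⟩, extend σ c⟩ : Prefix N) ∉ A := by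
  intro hmem
  rcases hA.eligible _ hmem with h | h
  · exact hc ((endsInMax_extend_iff _ σ c).1 h)
  · simp only [Prefix.size] at h
    lia

/-- A valid strike set contains every permutation of full size at which it is reached. -/
theorem IsValid.extend_mem_of_eq {A : Set (Prefix N)} (hA : IsValid A) {n : ℕ}
    (hn : n < N) (heq : n + 1 = N) {σ : Equiv.Perm (Fin n)} (hs : ¬ Stopped A σ)
    (c : Fin (n + 1)) : (⟨⟨n, hn⟩, extend σ c⟩ : Prefix N) ∈ A := by
  subst heq
  obtain ⟨i, hi⟩ := hA.covers (extend σ c)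
  have : Stopped A (extend σ c) := ⟨i, i.isLt, hi⟩
  exact ((stopped_extend_iff A hn σ c).1 this).resolve_left hs

theorem positional_mem_iff {k : ℕ} {n : ℕ} (hn : n < N) {σ : Equiv.Perm (Fin n)}
    (hs : ¬ Stopped (positional N k) σ) :
    (⟨⟨n, hn⟩, extend σ (Fin.last n)⟩ : Prefix N) ∈ positional N k ↔ k < n + 1 := by
  refine ⟨fun h => h.1, fun h => ?_⟩
  obtain ⟨q, hq, hqp⟩ := exists_positional_isPrefixOf (k := k)
    ⟨⟨n, hn⟩, extend σ (Fin.last n)⟩ h (Or.inl ((endsInMax_extend_iff hn σ _).2 rfl))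
  obtain ⟨h1, h2⟩ := id hqp
  have : Stopped (positional N k) (extend σ (Fin.last n)) :=
    ⟨q.1, h1, by rw [h2]; exact hq⟩
  exact ((stopped_extend_iff _ hn σ _).1 this).resolve_left hs

theorem winProb_positional {θ : ℝ} {k : ℕ} {Q V : ℕ → ℝ} (h : IsValue θ N k Q V) (hk : k < N) :
    winProb θ (positional N k) = V 0 :=
  winProb_eq_value h (fun _ hn _ hs => positional_mem_iff hn hs)
    fun _ _ σ _ hc hn => (isValid_positional hk).extend_notMem_of_ne_last hn σ hc

theorem IsOptimalValue.isOptimal_positional {θ : ℝ} {k : ℕ} {Q V : ℕ → ℝ}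
    (h : IsOptimalValue θ N k Q V) (hk : k < N) : IsOptimal θ (positional N k) := fun B =>
  (h.winProb_le B).trans (winProb_positional h.toIsValue hk).ge

/-- Valid strike sets that take the same decisions at left-to-right maxima are equal. -/
theorem IsValid.eq_of_mem_iff {A B : Set (Prefix N)} (hA : IsValid A) (hB : IsValid B) {k : ℕ}
    (hAk : ∀ n (hn : n < N) (σ : Equiv.Perm (Fin n)), ¬ Stopped A σ →
      ((⟨⟨n, hn⟩, extend σ (Fin.last n)⟩ : Prefix N) ∈ A ↔ k < n + 1))
    (hBk : ∀ n (hn : n < N) (σ : Equiv.Perm (Fin n)), ¬ Stopped B σ →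
      ((⟨⟨n, hn⟩, extend σ (Fin.last n)⟩ : Prefix N) ∈ B ↔ k < n + 1)) : A = B := by
  have key : ∀ n (hn : n < N) (π : Equiv.Perm (Fin (n + 1))),
      (⟨⟨n, hn⟩, π⟩ : Prefix N) ∈ A ↔ (⟨⟨n, hn⟩, π⟩ : Prefix N) ∈ B := by
    intro n
    induction n using Nat.strong_induction_on with
    | _ n ih =>
      intro hn π
      rw [exists_eq_extend π]
      generalize flatten n.le_succ π = σ
      generalize π (Fin.last n) = c
      -- Being stopped at `σ` depends only on prefixes of size at most `n`, where both sets agree by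
      -- induction.
      have hAB : Stopped A σ ↔ Stopped B σ :=
        exists_congr fun m => exists_congr fun h => ih m h m.isLt _
      by_cases hs : Stopped A σ
      · exact iff_of_false (hA.extend_notMem hn hs c) (hB.extend_notMem hn (hAB.1 hs) c)
      have hsB := mt hAB.2 hs
      rcases (Nat.succ_le_of_lt hn).lt_or_eq with hlt | heq
      · by_cases hc : c = Fin.last n
        · rw [hc, hAk n hn σ hs, hBk n hn σ hsB]
        · exact iff_of_false (hA.extend_notMem_of_ne_last hlt σ hc)
            (hB.extend_notMem_of_ne_last hlt σ hc)
      · exact iff_of_true (hA.extend_mem_of_eq hn heq hs c) (hB.extend_mem_of_eq hn heq hsB c)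
  ext ⟨⟨n, hn⟩, π⟩
  exact key n hn π

theorem IsOptimalValue.eq_positional {θ : ℝ} {k : ℕ} {Q V : ℕ → ℝ}
    (h : IsOptimalValue θ N k Q V) (hk : k < N) {A : Set (Prefix N)} (hA : IsValid A)
    (hopt : IsOptimal θ A) : A = positional N k := by
  have hV : winProb θ A = V 0 := le_antisymm (h.winProb_le A)
    ((winProb_positional h.toIsValue hk).symm.le.trans (hopt _))
  exact hA.eq_of_mem_iff (isValid_positional hk) (fun n hn σ hs => h.mem_iff hV hn hs)
    fun n hn σ hs => positional_mem_iff hn hs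

end

/-! ### The value function in closed form: the odds rule -/

/-- The probability that the best of the first `n` candidates is the best of all `N`. -/
noncomputable def stayProb (θ : ℝ) (N n : ℕ) : ℝ :=
  θ ^ (N - n) * (1 - θ ^ n) / (1 - θ ^ N)

/-- The sum of the odds of a left-to-right maximum over the candidates after the first `m`. -/
noncomputable def oddsSum (θ : ℝ) (N m : ℕ) : ℝ :=
  ∑ l ∈ Finset.Ico m N, (1 - θ) / (θ * (1 - θ ^ l))

/-- The probability of winning by accepting the first left-to-right maximum after the first
`max n k` candidates. -/
noncomputable def contValue (θ : ℝ) (N k n : ℕ) : ℝ :=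
  stayProb θ N (max n k) * oddsSum θ N (max n k)

section

variable {θ : ℝ}

theorem stayProb_step (h0 : 0 < θ) (h1 : θ < 1) {N n : ℕ} (hn : n < N) :
    stayProb θ N n = (1 - rankProb θ n (Fin.last n)) * stayProb θ N (n + 1) := by
  have hp : (1 : ℝ) - θ ^ (n + 1) ≠ 0 := (sub_pos.2 (pow_lt_one₀ h0.le h1 n.succ_ne_zero)).ne'
  have hN : N - n = (N - (n + 1)) + 1 := by lia
  have : 1 - (1 - θ) / (1 - θ ^ (n + 1)) = θ * (1 - θ ^ n) / (1 - θ ^ (n + 1)) := by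
    rw [eq_div_iff hp, sub_mul, div_mul_cancel₀ _ hp]
    ring
  rw [rankProb_last h1, stayProb, stayProb, hN, this, pow_succ]
  field_simp

theorem oddsSum_step {N n : ℕ} (hn : n < N) :
    oddsSum θ N n = (1 - θ) / (θ * (1 - θ ^ n)) + oddsSum θ N (n + 1) :=
  Finset.sum_eq_sum_Ico_succ_bot hn _

/-- With `r` the record probability this is `r / (1 - r)` in product form. The first candidate is a
record with certainty and has no finite odds, hence `n ≠ 0`. -/
theorem rankProb_eq_mul_odds (h0 : 0 < θ) (h1 : θ < 1) {n : ℕ} (hn : n ≠ 0) :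
    rankProb θ n (Fin.last n) =
      (1 - rankProb θ n (Fin.last n)) * ((1 - θ) / (θ * (1 - θ ^ n))) := by
  have hp : (1 : ℝ) - θ ^ (n + 1) ≠ 0 := (sub_pos.2 (pow_lt_one₀ h0.le h1 n.succ_ne_zero)).ne'
  have hq : (1 : ℝ) - θ ^ n ≠ 0 := (sub_pos.2 (pow_lt_one₀ h0.le h1 hn)).ne'
  have h0' := h0.ne'
  have : 1 - (1 - θ) / (1 - θ ^ (n + 1)) = θ * (1 - θ ^ n) / (1 - θ ^ (n + 1)) := by
    rw [eq_div_iff hp, sub_mul, div_mul_cancel₀ _ hp]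
    ring
  rw [rankProb_last h1, this]
  field_simp

theorem one_sub_pow_nonneg (h0 : 0 < θ) (h1 : θ < 1) (n : ℕ) : 0 ≤ 1 - θ ^ n :=
  sub_nonneg.2 (pow_le_one₀ h0.le h1.le)

theorem stayProb_nonneg (h0 : 0 < θ) (h1 : θ < 1) (N n : ℕ) : 0 ≤ stayProb θ N n :=
  div_nonneg (mul_nonneg (pow_pos h0 _).le (one_sub_pow_nonneg h0 h1 _))
    (one_sub_pow_nonneg h0 h1 _)

theorem stayProb_pos (h0 : 0 < θ) (h1 : θ < 1) {N n : ℕ} (hn : 0 < n) (hN : 0 < N) :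
    0 < stayProb θ N n :=
  div_pos (mul_pos (pow_pos h0 _) (sub_pos.2 (pow_lt_one₀ h0.le h1 hn.ne')))
    (sub_pos.2 (pow_lt_one₀ h0.le h1 hN.ne'))

theorem odds_nonneg (h0 : 0 < θ) (h1 : θ < 1) (l : ℕ) : 0 ≤ (1 - θ) / (θ * (1 - θ ^ l)) :=
  div_nonneg (sub_pos.2 h1).le (mul_nonneg h0.le (one_sub_pow_nonneg h0 h1 _))

theorem oddsSum_anti (h0 : 0 < θ) (h1 : θ < 1) (N : ℕ) {m n : ℕ} (h : m ≤ n) :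
    oddsSum θ N n ≤ oddsSum θ N m :=
  Finset.sum_le_sum_of_subset_of_nonneg (Finset.Ico_subset_Ico_left h)
    fun l _ _ => odds_nonneg h0 h1 l

theorem stayProb_mono (h0 : 0 < θ) (h1 : θ < 1) {N m n : ℕ} (h : m ≤ n) (hn : n ≤ N) :
    stayProb θ N m ≤ stayProb θ N n := by
  refine div_le_div_of_nonneg_right ?_ (one_sub_pow_nonneg h0 h1 _)
  exact mul_le_mul (pow_le_pow_of_le_one h0.le h1.le (by lia))
    (sub_le_sub_left (pow_le_pow_of_le_one h0.le h1.le h) _)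
    (one_sub_pow_nonneg h0 h1 _) (pow_pos h0 _).le

/-- The condition `0 < k` keeps the meaningless odds of the first candidate out of every sum. -/
theorem isValue_contValue (h0 : 0 < θ) (h1 : θ < 1) {N k : ℕ} (hk : 0 < k) (hkN : k < N) :
    IsValue θ N k (stayProb θ N) (contValue θ N k) where
  pos := h0
  stay_end := by
    have hN : (1 : ℝ) - θ ^ N ≠ 0 := (sub_pos.2 (pow_lt_one₀ h0.le h1 (by lia))).ne'
    simp [stayProb, hN]
  value_end := by simp [contValue, oddsSum, max_eq_left hkN.le]
  value_nonneg n := mul_nonneg (stayProb_nonneg h0 h1 _ _)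
    (Finset.sum_nonneg fun l _ => odds_nonneg h0 h1 l)
  stay_step n hn := stayProb_step h0 h1 hn
  value_step n hn := by
    by_cases hkn : k < n + 1
    · rw [if_pos hkn, contValue, contValue, max_eq_left (by lia), max_eq_left (by lia),
        oddsSum_step hn, stayProb_step h0 h1 hn]
      linear_combination (- stayProb θ N (n + 1)) * rankProb_eq_mul_odds h0 h1 (n := n) (by lia)
    · rw [if_neg hkn, contValue, contValue, max_eq_right (by lia), max_eq_right (by lia)]
      ring

/-- For `n > k`, continuing is worth the stay probability times an odds sum below 1. For `n ≤ k` it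
is worth the constant value at `k`, where the sum exceeds 1 and the stay probability is no smaller.
-/
theorem isOptimalValue_contValue (h0 : 0 < θ) (h1 : θ < 1) {N k : ℕ} (hk : 0 < k) (hkN : k < N)
    (hlt : 1 < oddsSum θ N k) (hgt : oddsSum θ N (k + 1) < 1) :
    IsOptimalValue θ N k (stayProb θ N) (contValue θ N k) where
  toIsValue := isValue_contValue h0 h1 hk hkN
  lt_stay n hkn hnN := by
    rw [contValue, max_eq_left hkn.le]
    exact mul_lt_of_lt_one_right (stayProb_pos h0 h1 (by lia) (by lia))
      ((oddsSum_anti h0 h1 N hkn).trans_lt hgt)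
  stay_lt n hn hnk := by
    rw [contValue, max_eq_right hnk]
    exact (stayProb_mono h0 h1 hnk hkN.le).trans_lt
      (lt_mul_of_one_lt_right (stayProb_pos h0 h1 hk (by lia)) hlt)

/-! ### Limits for large `N` -/

theorem oddsSum_sub_eq {N j : ℕ} (hj : j ≤ N) : oddsSum θ N (N - j) =
    ∑ t ∈ Finset.range j, (1 - θ) / (θ * (1 - θ ^ (N - j + t))) := by
  rw [oddsSum, Finset.sum_Ico_eq_sum_range, Nat.sub_sub_self hj]

theorem tendsto_pow_sub (h0 : 0 < θ) (h1 : θ < 1) (j t : ℕ) :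
    Tendsto (fun N : ℕ => θ ^ (N - j + t)) atTop (𝓝 0) :=
  (tendsto_pow_atTop_nhds_zero_of_lt_one h0.le h1).comp
    (tendsto_atTop_mono (fun _ => Nat.le_add_right _ t) (tendsto_sub_atTop_nat j))

theorem tendsto_oddsSum (h0 : 0 < θ) (h1 : θ < 1) (j : ℕ) :
    Tendsto (fun N : ℕ => oddsSum θ N (N - j)) atTop (𝓝 (j * ((1 - θ) / θ))) := by
  have h : Tendsto (fun N : ℕ => ∑ t ∈ Finset.range j, (1 - θ) / (θ * (1 - θ ^ (N - j + t))))
      atTop (𝓝 (∑ t ∈ Finset.range j, (1 - θ) / (θ * (1 - 0)))) := by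
    refine tendsto_finsetSum _ fun t _ => ?_
    refine tendsto_const_nhds.div (tendsto_const_nhds.mul
      (tendsto_const_nhds.sub (tendsto_pow_sub h0 h1 j t))) (by simpa using h0.ne')
  simp only [sub_zero, mul_one, Finset.sum_const, Finset.card_range, nsmul_eq_mul] at h
  refine h.congr' ?_
  filter_upwards [eventually_ge_atTop j] with N hN
  rw [oddsSum_sub_eq hN]

/-- Each factor `1 - θ ^ l` lies below 1, so the limit is approached from strictly above; this
breaks the tie when `j * (1 - θ) = θ`. -/
theorem lt_oddsSum (h0 : 0 < θ) (h1 : θ < 1) {N j : ℕ} (hj : 0 < j) (hN : j < N) :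
    j * ((1 - θ) / θ) < oddsSum θ N (N - j) := by
  rw [oddsSum_sub_eq hN.le, ← nsmul_eq_mul]
  nth_rw 1 [← Finset.card_range j]
  rw [← Finset.sum_const]
  refine Finset.sum_lt_sum_of_nonempty (Finset.nonempty_range_iff.2 hj.ne') fun t _ => ?_
  have hp : 0 < 1 - θ ^ (N - j + t) := sub_pos.2 (pow_lt_one₀ h0.le h1 (by lia))
  have : 0 < θ ^ (N - j + t) := pow_pos h0 _
  exact div_lt_div_of_pos_left (sub_pos.2 h1) (mul_pos h0 hp)
    (mul_lt_of_lt_one_right h0 (by linarith))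

theorem tendsto_stayProb (h0 : 0 < θ) (h1 : θ < 1) (j : ℕ) :
    Tendsto (fun N : ℕ => stayProb θ N (N - j)) atTop (𝓝 (θ ^ j)) := by
  have h : Tendsto (fun N : ℕ => θ ^ j * (1 - θ ^ (N - j)) / (1 - θ ^ N)) atTop
      (𝓝 (θ ^ j * (1 - 0) / (1 - 0))) :=
    (tendsto_const_nhds.mul (tendsto_const_nhds.sub (tendsto_pow_sub h0 h1 j 0))).div
      (tendsto_const_nhds.sub (tendsto_pow_atTop_nhds_zero_of_lt_one h0.le h1)) (by simp)
  simp only [sub_zero, mul_one, div_one] at h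
  refine h.congr' ?_
  filter_upwards [eventually_ge_atTop j] with N hN
  rw [stayProb, Nat.sub_sub_self hN]

theorem tendsto_winProb_positional (h0 : 0 < θ) (h1 : θ < 1) {j : ℕ} (hj : 1 ≤ j) :
    Tendsto (fun N : ℕ => winProb θ (positional N (N - j))) atTop
      (𝓝 ((j : ℝ) * θ ^ ((j : ℝ) - 1) * (1 - θ))) := by
  have h := (tendsto_stayProb h0 h1 j).mul (tendsto_oddsSum h0 h1 j)
  have hlim : θ ^ j * (j * ((1 - θ) / θ)) = (j : ℝ) * θ ^ ((j : ℝ) - 1) * (1 - θ) := by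
    rw [Real.rpow_sub h0, Real.rpow_natCast, Real.rpow_one]
    ring
  rw [hlim] at h
  refine h.congr' ?_
  filter_upwards [eventually_gt_atTop j] with N hN
  rw [winProb_positional (isValue_contValue h0 h1 (by lia) (by lia)) (by lia), contValue,
    max_eq_right (Nat.zero_le _)]

/-- If `j` is the least natural number with `θ ≤ j * (1 - θ)`, then rejecting all but the last `j`
candidates is optimal for all large `N`, and the only valid optimal strategy. -/
theorem eventually_positional_optimal (h0 : 0 < θ) (h1 : θ < 1) {j : ℕ} (hj : 1 ≤ j)
    (hle : θ / (1 - θ) ≤ j) (hlt : (j : ℝ) - 1 < θ / (1 - θ)) :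
    ∀ᶠ N : ℕ in atTop, IsValid (positional N (N - j)) ∧ IsOptimal θ (positional N (N - j)) ∧
      ∀ A : Set (Prefix N), IsValid A → IsOptimal θ A → A = positional N (N - j) := by
  have h1' : 0 < 1 - θ := sub_pos.2 h1
  have hlt' : ((j - 1 : ℕ) : ℝ) * ((1 - θ) / θ) < 1 := by
    rw [Nat.cast_sub hj, Nat.cast_one, ← mul_div_assoc, div_lt_one h0]
    exact (lt_div_iff₀ h1').1 hlt
  have hle' : 1 ≤ j * ((1 - θ) / θ) := by
    rw [← mul_div_assoc, one_le_div h0]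
    exact (div_le_iff₀ h1').1 hle
  filter_upwards [eventually_gt_atTop j, (tendsto_oddsSum h0 h1 (j - 1)).eventually_lt_const hlt']
    with N hN hgt
  have hk : N - (j - 1) = N - j + 1 := by lia
  rw [hk] at hgt
  have h := isOptimalValue_contValue h0 h1 (N := N) (k := N - j) (by lia) (by lia)
    (hle'.trans_lt (lt_oddsSum h0 h1 (by lia) hN)) hgt
  exact ⟨isValid_positional (by lia), h.isOptimal_positional (by lia),
    fun A hA hopt => h.eq_positional (by lia) hA hopt⟩

/-! ### The real maximum and the rounding of `J` -/

/-- After taking logarithms, concavity suffices: `log u < u - 1` at `u = x / J` bounds the gain from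
the factor `x`, and the linear term pays for it. -/
theorem mul_rpow_lt_max (h0 : 0 < θ) (h1 : θ < 1) {x : ℝ} (hx : 1 ≤ x)
    (hne : x ≠ max (-1 / Real.log θ) 1) :
    x * θ ^ (x - 1) * (1 - θ) <
      max (-1 / Real.log θ) 1 * θ ^ (max (-1 / Real.log θ) 1 - 1) * (1 - θ) := by
  refine mul_lt_mul_of_pos_right ?_ (sub_pos.2 h1)
  set J := max (-1 / Real.log θ) 1 with hJ
  have hJ1 : 1 ≤ J := le_max_right _ _
  have hJ0 : 0 < J := by linarith
  have hx0 : 0 < x := by linarith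
  have hL : 0 < -Real.log θ := neg_pos.2 (Real.log_neg h0 h1)
  rw [← Real.log_lt_log_iff (by positivity) (by positivity), Real.log_mul hx0.ne' (by positivity),
    Real.log_mul hJ0.ne' (by positivity), Real.log_rpow h0, Real.log_rpow h0]
  have hratio : Real.log x - Real.log J < x / J - 1 := by
    rw [← Real.log_div hx0.ne' hJ0.ne']
    refine Real.log_lt_sub_one_of_pos (by positivity) fun h => hne ?_
    rwa [div_eq_one_iff_eq hJ0.ne'] at h
  -- Equality holds at the critical point `J = -1 / log θ`; at the boundary `J = 1` the inequality
  -- uses `x ≥ 1` and `-log θ ≥ 1`.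
  have hslope : x / J - 1 ≤ (x - J) * -Real.log θ := by
    rcases le_total (-1 / Real.log θ) 1 with hc | hc
    · have hJ' : J = 1 := max_eq_right hc
      have : 1 ≤ -Real.log θ := by
        rw [← neg_div_neg_eq, neg_neg, div_le_one hL] at hc
        exact hc
      rw [hJ']
      nlinarith
    · have hJ' : J = -1 / Real.log θ := max_eq_left hc
      have hlog : Real.log θ ≠ 0 := by linarith
      rw [hJ']
      apply le_of_eq
      field_simp
      ring
  nlinarith

/-- Both bounds are `log u < u - 1`, at `u = θ⁻¹` for the lower and `u = θ` for the upper. -/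
theorem inv_neg_log_bounds (h0 : 0 < θ) (h1 : θ < 1) :
    θ / (1 - θ) < -1 / Real.log θ ∧ -1 / Real.log θ < θ / (1 - θ) + 1 := by
  have h1' : 0 < 1 - θ := sub_pos.2 h1
  have hL : 0 < -Real.log θ := neg_pos.2 (Real.log_neg h0 h1)
  have hu := Real.log_lt_sub_one_of_pos h0 h1.ne
  have hl := Real.log_lt_sub_one_of_pos (inv_pos.2 h0) (by
    rw [Ne, inv_eq_one]
    exact h1.ne)
  rw [Real.log_inv] at hl
  rw [← neg_div_neg_eq (-1), neg_neg]
  constructor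
  · rw [div_lt_div_iff₀ h1' hL]
    have := mul_lt_mul_of_pos_left hl h0
    rw [mul_sub, mul_inv_cancel₀ h0.ne'] at this
    linarith
  · have : θ / (1 - θ) + 1 = 1 / (1 - θ) := by
      field_simp
      ring
    rw [this]
    exact one_div_lt_one_div_of_lt h1' (by linarith)

/-- With `m = ⌈θ / (1 - θ)⌉₊`, the bounds give `m ≤ ⌈J⌉₊` and `J < m + 1`; if `m < ⌈J⌉₊`, then `m <
J`, so `m` is the floor. -/
theorem ceil_odds_eq_floor_or_ceil (h0 : 0 < θ) (h1 : θ < 1) :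
    ⌈θ / (1 - θ)⌉₊ = ⌊max (-1 / Real.log θ) 1⌋₊ ∨ ⌈θ / (1 - θ)⌉₊ = ⌈max (-1 / Real.log θ) 1⌉₊ := by
  obtain ⟨hl, hu⟩ := inv_neg_log_bounds h0 h1
  have hpos : 0 < θ / (1 - θ) := div_pos h0 (sub_pos.2 h1)
  have hJpos : 0 < max (-1 / Real.log θ) 1 := by positivity
  have hle : ⌈θ / (1 - θ)⌉₊ ≤ ⌈max (-1 / Real.log θ) 1⌉₊ :=
    Nat.ceil_mono (hl.le.trans (le_max_left _ _))
  rcases hle.lt_or_eq with hlt | heq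
  · left
    symm
    rw [Nat.floor_eq_iff hJpos.le]
    refine ⟨(Nat.lt_ceil.1 hlt).le, max_lt ?_ ?_⟩
    · linarith [Nat.le_ceil (θ / (1 - θ))]
    · have : 0 < ⌈θ / (1 - θ)⌉₊ := Nat.ceil_pos.2 hpos
      have : (0 : ℝ) < ⌈θ / (1 - θ)⌉₊ := by exact_mod_cast this
      linarith
  · exact Or.inr heq

theorem max_value_eq (h0 : 0 < θ) (h1 : θ < 1) (he : Real.exp (-1) < θ) :
    max (-1 / Real.log θ) 1 * θ ^ (max (-1 / Real.log θ) 1 - 1) * (1 - θ) =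
      Real.exp (-1) * ((θ - 1) / (θ * Real.log θ)) := by
  have hlog : Real.log θ < 0 := Real.log_neg h0 h1
  have hlog' : -1 < Real.log θ := (Real.lt_log_iff_exp_lt h0).2 he
  have hmax : max (-1 / Real.log θ) 1 = -1 / Real.log θ := by
    refine max_eq_left ?_
    rw [one_le_div_of_neg hlog]
    exact hlog'.le
  have hpow : θ ^ (-1 / Real.log θ) = Real.exp (-1) := by
    rw [Real.rpow_def_of_pos h0, mul_div_cancel₀ _ hlog.ne]
  rw [hmax, Real.rpow_sub h0, hpow, Real.rpow_one]
  have := hlog.ne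
  field_simp
  ring

end

end BestChoice

theorem theorem5p4 (θ : ℝ) (hθ0 : 0 < θ) (hθ1 : θ < 1) :
    -- for each integer `j ≥ 1`, rejecting all but the last `j` candidates and taking the next
    -- left-to-right maximum succeeds, in the limit, with probability `j θ ^ (j - 1) (1 - θ)`
    (∀ j : ℕ, 1 ≤ j →
      Tendsto (fun N : ℕ => BestChoice.winProb θ (BestChoice.positional N (N - j))) atTop
        (𝓝 ((j : ℝ) * θ ^ ((j : ℝ) - 1) * (1 - θ)))) ∧
    -- this expression is, for real `x ≥ 1`, maximal exactly at `x = max (-1 / log θ) 1`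
    (∀ x : ℝ, 1 ≤ x → x ≠ max (-1 / Real.log θ) 1 →
      x * θ ^ (x - 1) * (1 - θ) <
        max (-1 / Real.log θ) 1 * θ ^ (max (-1 / Real.log θ) 1 - 1) * (1 - θ)) ∧
    -- for all large `N`, the optimal strategy rejects all but the last `j` candidates, where `j`
    -- is `max (-1 / log θ) 1`, rounded to one of the two adjacent integers if not an integer
    (∃ j : ℕ, 1 ≤ j ∧
      (j = ⌊max (-1 / Real.log θ) 1⌋₊ ∨ j = ⌈max (-1 / Real.log θ) 1⌉₊) ∧
      ∀ᶠ N : ℕ in atTop,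
        BestChoice.IsValid (BestChoice.positional N (N - j)) ∧
        BestChoice.IsOptimal θ (BestChoice.positional N (N - j)) ∧
        ∀ A : Set (BestChoice.Prefix N), BestChoice.IsValid A → BestChoice.IsOptimal θ A →
          A = BestChoice.positional N (N - j)) ∧
    -- the closed form for `1 / e < θ < 1`
    (Real.exp (-1) < θ →
      max (-1 / Real.log θ) 1 * θ ^ (max (-1 / Real.log θ) 1 - 1) * (1 - θ) =
        Real.exp (-1) * ((θ - 1) / (θ * Real.log θ))) := by
  have hpos : 0 < θ / (1 - θ) := div_pos hθ0 (sub_pos.2 hθ1)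
  refine ⟨fun j hj => BestChoice.tendsto_winProb_positional hθ0 hθ1 hj,
    fun x hx hne => BestChoice.mul_rpow_lt_max hθ0 hθ1 hx hne,
    ⟨⌈θ / (1 - θ)⌉₊, Nat.ceil_pos.2 hpos, BestChoice.ceil_odds_eq_floor_or_ceil hθ0 hθ1,
      BestChoice.eventually_positional_optimal hθ0 hθ1 (Nat.ceil_pos.2 hpos) (Nat.le_ceil _) ?_⟩,
    fun he => BestChoice.max_value_eq hθ0 hθ1 he⟩
  linarith [Nat.ceil_lt_add_one hpos.le]
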